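/- Let $\mathbb S$ be the set of all strictly decreasing sequences $s=(s_n)_{n\ge 1}$ of positive reals converging to $0$. For $S,S'\subseteq\mathbb S$ write $S'\le S$ if for every $s\in S$ there is $s'\in S'$ with $s'_n\le s_n$ for all $n$, and $S'\equiv S$ if $S'\le S$ and $S\le S'$. The set $S$ is called countably determined if there is a countable $S'\subseteq\mathbb S$ with $S'\equiv S$. A metric space $K$ is called $S$-dominated if for each $s\in S$ there is a sequence $(E_n)_{n\ge1}$ of subsets of $K$ covering $K$ with $\operatorname{diam}E_n<s_n$ for all $n\ge 1$. Let $\mathcal K_{\mathsf{GH}}$ be the space of all (isometry classes of) nonempty compact metric spaces, equipped with the Gromov–Hausdorff metric. **Theorem.** If $S\subseteq\mathbb S$ is countably determined, then a typical $K\in\mathcal K_{\mathsf{GH}}$ is $S$-dominated; that is, the set of all $S$-dominated $K\in\mathcal K_{\mathsf{GH}}$ is comeager in $\mathcal K_{\mathsf{GH}}$ (its complement is a countable union of nowhere dense sets). -/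

import Mathlib

open Set Filter Topology

namespace DominatedSets

/-- The family of all strictly decreasing sequences, indexed by the positive integers,
of positive reals converging to `0`. -/
def decreasingSeqs : Set (ℕ+ → ℝ) :=
  {s | (∀ n, 0 < s n) ∧ StrictAnti s ∧ Tendsto s atTop (𝓝 0)}

/-- `S' ≤ S`: every `s ∈ S` lies pointwise above some `s' ∈ S'`. -/
def FamilyLE (S' S : Set (ℕ+ → ℝ)) : Prop :=
  ∀ s ∈ S, ∃ s' ∈ S', ∀ n, s' n ≤ s n

/-- `S' ≡ S`: both `S' ≤ S` and `S ≤ S'`. -/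
def FamilyEquiv (S' S : Set (ℕ+ → ℝ)) : Prop :=
  FamilyLE S' S ∧ FamilyLE S S'

/-- `S` is countably determined if some countable family `S'` of strictly decreasing positive
sequences converging to `0` satisfies `S' ≡ S`. -/
def CountablyDetermined (S : Set (ℕ+ → ℝ)) : Prop :=
  ∃ S' ⊆ decreasingSeqs, S'.Countable ∧ FamilyEquiv S' S

/-- A sequence of sets is `s`-fine if `diam (E n) < s n` for all `n`. The diameter is the
extended one, so that sets of infinite diameter are never allowed. -/
def IsFine {X : Type*} [MetricSpace X] (s : ℕ+ → ℝ) (E : ℕ+ → Set X) : Prop :=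
  ∀ n, Metric.ediam (E n) < ENNReal.ofReal (s n)

/-- `A` is `S`-dominated if for each `s ∈ S` there is an `s`-fine cover of `A`. -/
def IsDominated {X : Type*} [MetricSpace X] (S : Set (ℕ+ → ℝ)) (A : Set X) : Prop :=
  ∀ s ∈ S, ∃ E : ℕ+ → Set X, IsFine s E ∧ A ⊆ ⋃ n, E n

/-- Whether a space is dominated depends only on its isometry class, so for a point of the
Gromov–Hausdorff space it may be tested on any representative. -/
theorem isDominated_univ_iff_of_isometryEquiv {X Y : Type*} [MetricSpace X] [MetricSpace Y]
    (e : X ≃ᵢ Y) (S : Set (ℕ+ → ℝ)) :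
    IsDominated S (univ : Set X) ↔ IsDominated S (univ : Set Y) := by
  constructor
  · intro h s hs
    obtain ⟨E, hE, hc⟩ := h s hs
    refine ⟨fun n => e '' E n, fun n => ?_, fun y _ => ?_⟩
    · rw [e.isometry.ediam_image]
      exact hE n
    · obtain ⟨n, hn⟩ := mem_iUnion.1 (hc (mem_univ (e.symm y)))
      exact mem_iUnion.2 ⟨n, e.symm y, hn, e.apply_symm_apply y⟩
  · intro h s hs
    obtain ⟨E, hE, hc⟩ := h s hs
    refine ⟨fun n => e.symm '' E n, fun n => ?_, fun x _ => ?_⟩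
    · rw [e.symm.isometry.ediam_image]
      exact hE n
    · obtain ⟨n, hn⟩ := mem_iUnion.1 (hc (mem_univ (e x)))
      exact mem_iUnion.2 ⟨n, e x, hn, e.symm_apply_apply x⟩

end DominatedSets

namespace DominatedSets

open GromovHausdorff

/-! Being comeager survives countable intersections, so a countable equivalent family reduces the
claim to one sequence `s`. Finite spaces are dense, and around an `N`-point space a whole ball
consists of spaces with `s`-fine covers: only `N` sets are needed, and `s N` is the tightest of
their `N` bounds. Hence the good set has dense interior. -/

/-- A family that lies below a dominating one pointwise is dominating as well. -/
theorem IsDominated.of_familyLE {X : Type*} [MetricSpace X] {S' S : Set (ℕ+ → ℝ)} {A : Set X}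
    (h : IsDominated S' A) (hle : FamilyLE S' S) : IsDominated S A := by
  intro s hs
  obtain ⟨s', hs', hss⟩ := hle s hs
  obtain ⟨E, hE, hc⟩ := h s' hs'
  exact ⟨E, fun n => (hE n).trans_le (ENNReal.ofReal_le_ofReal (hss n)), hc⟩

/-- A compact space that is Gromov–Hausdorff close to a finite one has an `s`-fine cover, where
the required closeness depends on `s` and the finite space only. -/
theorem exists_forall_ghDist_lt_isDominated {s : ℕ+ → ℝ} (hs : s ∈ decreasingSeqs)
    (X : Type*) [MetricSpace X] [CompactSpace X] [Nonempty X] [Finite X] :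
    ∃ δ > 0, ∀ (Y : Type) [MetricSpace Y] [CompactSpace Y] [Nonempty Y],
      ghDist X Y < δ → IsDominated {s} (univ : Set Y) := by
  have := Fintype.ofFinite X
  let e := Fintype.equivFin X
  let N : ℕ+ := ⟨Fintype.card X, Fintype.card_pos⟩
  have hN : 0 < s N := hs.1 N
  -- Two points within `s N / 4` of the same `x` are at most `s N / 2 < s N` apart.
  refine ⟨s N / 4, by positivity, fun Y _ _ _ hXY => ?_⟩
  intro t ht
  rw [mem_singleton_iff.1 ht]
  -- In the optimal coupling, the `n`-th set gathers the points near the `n`-th point of `X`; it is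
  -- empty for `n > N`. The shift by one matches indices starting at `1`.
  refine ⟨fun n => {y | ∃ x, (e x : ℕ) + 1 = n ∧
    dist (optimalGHInjl X Y x) (optimalGHInjr X Y y) < s N / 4}, fun n => ?_, fun y _ => ?_⟩
  · by_cases hn : n ≤ N
    · have hsn : s N ≤ s n := hs.2.1.antitone hn
      refine (Metric.ediam_le (d := ENNReal.ofReal (s N / 2)) ?_).trans_lt
        ((ENNReal.ofReal_lt_ofReal_iff (hs.1 n)).2 (by linarith))
      rintro y ⟨x, hx, hxy⟩ z ⟨x', hx', hxz⟩
      obtain rfl : x = x' := e.injective (Fin.ext (by omega))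
      rw [edist_dist]
      refine ENNReal.ofReal_le_ofReal ?_
      rw [← (isometry_optimalGHInjr X Y).dist_eq]
      have := dist_triangle_left (optimalGHInjr X Y y) (optimalGHInjr X Y z)
        (optimalGHInjl X Y x)
      linarith
    · refine (Metric.ediam_subsingleton ?_).trans_lt (ENNReal.ofReal_pos.2 (hs.1 n))
      rintro y ⟨x, hx, -⟩
      refine absurd (PNat.coe_le_coe _ _ |>.1 ?_) hn
      rw [← hx]
      exact (e x).isLt
  · rw [← hausdorffDist_optimal] at hXY
    obtain ⟨_, ⟨x, rfl⟩, hx⟩ := Metric.exists_dist_lt_of_hausdorffDist_lt'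
      (mem_range_self y) hXY (Metric.hausdorffEDist_ne_top_of_nonempty_of_bounded
        (range_nonempty _) (range_nonempty _)
        (isCompact_range (isometry_optimalGHInjl X Y).continuous).isBounded
        (isCompact_range (isometry_optimalGHInjr X Y).continuous).isBounded)
    exact mem_iUnion.2 ⟨⟨(e x : ℕ) + 1, Nat.succ_pos _⟩, x, rfl, hx⟩

/-- Finite metric spaces are dense in the Gromov–Hausdorff space. -/
theorem exists_finite_ghDist_le (X : Type*) [MetricSpace X] [CompactSpace X] [Nonempty X]
    {ε : ℝ} (hε : 0 < ε) :
    ∃ F : Set X, F.Finite ∧ F.Nonempty ∧ ∀ [CompactSpace F] [Nonempty F], ghDist X F ≤ ε := by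
  obtain ⟨F, -, hF, hc⟩ := (isCompact_univ (X := X)).finite_cover_balls hε
  have hd : ∀ x : X, ∃ y ∈ F, dist x y ≤ ε := fun x => by
    obtain ⟨y, hy, hxy⟩ := mem_iUnion₂.1 (hc (mem_univ x))
    exact ⟨y, hy, (Metric.mem_ball.1 hxy).le⟩
  refine ⟨F, hF, (hd (Classical.arbitrary X)).imp fun _ h => h.1, ?_⟩
  intro _ _
  refine (ghDist_le_hausdorffDist (Φ := (id : X → X)) (Ψ := ((↑) : F → X)) isometry_id
    isometry_subtype_coe).trans (Metric.hausdorffDist_le_of_mem_dist hε.le ?_ ?_)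
  · rw [Subtype.range_coe]
    exact fun x _ => hd x
  · exact fun x _ => ⟨x, mem_range_self x, by simpa using hε.le⟩

/-- For a single sequence `s`, a typical compact metric space has an `s`-fine cover. -/
theorem isDominated_singleton_mem_residual {s : ℕ+ → ℝ} (hs : s ∈ decreasingSeqs) :
    {K : GHSpace | IsDominated {s} (univ : Set K.Rep)} ∈ residual GHSpace := by
  refine mem_of_superset (residual_of_dense_open isOpen_interior ?_) interior_subset
  refine Metric.dense_iff.2 fun K ε hε => ?_
  obtain ⟨F, hF, hne, hd⟩ := exists_finite_ghDist_le K.Rep (half_pos hε)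
  have := hF.to_subtype
  have := hne.to_subtype
  obtain ⟨δ, hδ, h⟩ := exists_forall_ghDist_lt_isDominated hs F
  refine ⟨toGHSpace F, ?_, ?_⟩
  · rw [Metric.mem_ball']
    have := hd
    rw [ghDist, K.toGHSpace_rep] at this
    linarith
  · refine mem_interior_iff_mem_nhds.2 (Metric.mem_nhds_iff.2 ⟨δ, hδ, fun L hL => h L.Rep ?_⟩)
    rw [ghDist, L.toGHSpace_rep]
    exact Metric.mem_ball'.1 hL

end DominatedSets

theorem mainTheorem11 (S : Set (ℕ+ → ℝ)) (hS : S ⊆ DominatedSets.decreasingSeqs)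
    (hcd : DominatedSets.CountablyDetermined S) :
    {K : GromovHausdorff.GHSpace |
      DominatedSets.IsDominated S (Set.univ : Set K.Rep)} ∈ residual GromovHausdorff.GHSpace := by
  obtain ⟨S', hS', hcount, hle, -⟩ := hcd
  refine mem_of_superset ((countable_bInter_mem hcount).2 fun s hs =>
    DominatedSets.isDominated_singleton_mem_residual (hS' hs)) fun K hK => ?_
  have hK' : DominatedSets.IsDominated S' (univ : Set K.Rep) :=
    fun s hs => mem_iInter₂.1 hK s hs s rfl
  exact hK'.of_familyLE hle
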